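/- Let $\mathbb{F}_q$ be a finite field with $q$ elements, and let $\mathcal{C}$ be a geometrically irreducible projective plane curve of degree $d>1$ defined over $\mathbb{F}_q$, i.e. $\mathcal{C}: f=0$ where $f\in\mathbb{F}_q[X_0,X_1,X_2]$ is homogeneous of degree $d$ and irreducible over $\overline{\mathbb{F}}_q$. Let $\mathcal{X}$ be the nonsingular model of $\mathcal{C}$; its points are the branches of $\mathcal{C}$ over $\overline{\mathbb{F}}_q$, i.e. the discrete valuation rings of the function field $\overline{\mathbb{F}}_q(\mathcal{C})$ that contain $\overline{\mathbb{F}}_q$. For $r\ge 1$ let $\mathcal{X}(\mathbb{F}_{q^r})$ be the set of points of $\mathcal{X}$ fixed by the $q^r$-Frobenius. For $P\in\mathcal{X}$ let $v_P$ be the normalized discrete valuation at $P$, let $f_i=x_i/x_0$ $(i=0,1,2)$ be the coordinate functions, and let $j_0(P)<j_1(P)<j_2(P)$ be the order sequence of $P$ with respect to lines, i.e. the three integers of the form $$v_P(a_0f_0+a_1f_1+a_2f_2)-\min_{0\le i\le 2}v_P(f_i),\qquad (a_0:a_1:a_2)\in\mathbb{P}^2(\overline{\mathbb{F}}_q).$$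 Then the sets $\mathcal{X}(\mathbb{F}_q)$ and $\mathcal{X}(\mathbb{F}_{q^2})$ are finite and, with $N_i=\#\mathcal{X}(\mathbb{F}_{q^i})$ for $i=1,2$, $$(q+1)N_1+N_2\ \le\ d(q^2+q+1)-\sum_{P\in\mathcal{X}(\mathbb{F}_q)}\Bigl(q\,(j_1(P)-1)+(j_2(P)-2)\Bigr).$$ -/

import Mathlib

noncomputable section

/-- A (geometrically irreducible) projective plane curve of degree `d` defined over `F`: a
homogeneous polynomial of degree `d` in three variables over `F` that is irreducible over the
algebraic closure of `F`. -/
structure PlaneCurve (F : Type*) [Field F] (d : ℕ) where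
  poly : MvPolynomial (Fin 3) F
  isHomogeneous : poly.IsHomogeneous d
  irreducible : Irreducible (MvPolynomial.map (algebraMap F (AlgebraicClosure F)) poly)

namespace PlaneCurve

variable {F : Type*} [Field F] {d : ℕ} (C : PlaneCurve F d)

/-- The defining polynomial over the algebraic closure. -/
def geomPoly : MvPolynomial (Fin 3) (AlgebraicClosure F) :=
  MvPolynomial.map (algebraMap F (AlgebraicClosure F)) C.poly

/-- The homogeneous ideal of the curve over the algebraic closure. -/
def ideal : Ideal (MvPolynomial (Fin 3) (AlgebraicClosure F)) :=
  Ideal.span {C.geomPoly}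

instance : C.ideal.IsPrime :=
  (Ideal.span_singleton_prime C.irreducible.ne_zero).2 C.irreducible.prime

/-- The homogeneous coordinate ring over the algebraic closure. -/
abbrev CoordRing : Type _ :=
  MvPolynomial (Fin 3) (AlgebraicClosure F) ⧸ C.ideal

/-- The fraction field of the homogeneous coordinate ring (functions on the affine cone). -/
abbrev ConeField : Type _ := FractionRing C.CoordRing

/-- The homogeneous coordinates `x₀, x₁, x₂`. -/
def homCoord (i : Fin 3) : C.ConeField :=
  algebraMap C.CoordRing C.ConeField (Ideal.Quotient.mk C.ideal (MvPolynomial.X i))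

/-- The function field of the curve over the algebraic closure: the subfield of the
fraction field of the homogeneous coordinate ring that is generated over the constants by the
quotients `xᵢ / xⱼ` (the quotients of forms of equal degree). -/
def functionField : IntermediateField (AlgebraicClosure F) C.ConeField :=
  IntermediateField.adjoin (AlgebraicClosure F)
    {z | ∃ i j : Fin 3, z = C.homCoord i / C.homCoord j}

/-- The rational functions `fᵢ = xᵢ / x₀`; the morphism from the nonsingular model to the
projective plane is `(f₀ : f₁ : f₂)`. -/
def coord (i : Fin 3) : C.functionField :=
  ⟨C.homCoord i / C.homCoord 0, IntermediateField.subset_adjoin _ _ ⟨i, 0, rfl⟩⟩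

/-- A point of the nonsingular model over the algebraic closure (a branch of the curve): a
discrete valuation ring of the function field that contains the constants. -/
@[ext]
structure Point where
  ring : ValuationSubring C.functionField
  const_mem : ∀ c : AlgebraicClosure F, algebraMap (AlgebraicClosure F) C.functionField c ∈ ring
  dvr : IsDiscreteValuationRing ring

namespace Point

variable {C} (P : C.Point)

/-- The normalized discrete valuation `v_P` (with value `0` at the zero function). -/
def ord (z : C.functionField) : ℤ :=
  haveI : IsDiscreteValuationRing P.ring := P.dvr;
  -WithZero.log ((IsDiscreteValuationRing.maximalIdeal P.ring).valuation C.functionField z)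

/-- The number `e_P = -min (v_P(f₀), v_P(f₁), v_P(f₂))`. -/
def e : ℤ := -Finset.univ.inf' Finset.univ_nonempty fun i : Fin 3 => P.ord (C.coord i)

/-- `j` is a `(𝒟, P)`-order for the linear series `𝒟` cut out by lines: the multiplicity at `P`
of the divisor `div (a₀ f₀ + a₁ f₁ + a₂ f₂) + E` for some line `(a₀ : a₁ : a₂)`. -/
def IsOrder (j : ℕ) : Prop :=
  ∃ a : Fin 3 → AlgebraicClosure F, a ≠ 0 ∧ (j : ℤ) = P.ord (∑ i, a i • C.coord i) + P.e

/-- The order sequence `j₀(P) < j₁(P) < j₂(P)`: the increasing enumeration of the orders. -/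
def order (i : ℕ) : ℕ := Nat.nth P.IsOrder i

end Point

section Frobenius

variable [Fintype F]

/-- The `q`-Frobenius on coefficients of polynomials over the algebraic closure. -/
def polyFrobenius :
    MvPolynomial (Fin 3) (AlgebraicClosure F) ≃+* MvPolynomial (Fin 3) (AlgebraicClosure F) :=
  MvPolynomial.mapEquiv (Fin 3)
    (FiniteField.frobeniusAlgEquivOfAlgebraic F (AlgebraicClosure F)).toRingEquiv

theorem polyFrobenius_geomPoly : polyFrobenius C.geomPoly = C.geomPoly := by
  show MvPolynomial.map _ (MvPolynomial.map _ C.poly) = MvPolynomial.map _ C.poly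
  rw [MvPolynomial.map_map]
  congr 2
  refine RingHom.ext fun c => ?_
  exact (FiniteField.frobeniusAlgEquivOfAlgebraic F (AlgebraicClosure F)).commutes c

theorem ideal_eq_map : C.ideal = C.ideal.map (polyFrobenius (F := F) : _ →+* _) := by
  rw [ideal, Ideal.map_span, Set.image_singleton]
  exact congrArg (fun z => Ideal.span {z}) C.polyFrobenius_geomPoly.symm

/-- The Frobenius automorphism of the cone field: it fixes `x₀, x₁, x₂` and raises the
constants to the power `q`. -/
def coneFrobenius : C.ConeField ≃+* C.ConeField :=
  IsFractionRing.ringEquivOfRingEquiv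
    (Ideal.quotientEquiv C.ideal C.ideal polyFrobenius C.ideal_eq_map)

theorem coneFrobenius_homCoord (i : Fin 3) :
    C.coneFrobenius (C.homCoord i) = C.homCoord i := by
  rw [coneFrobenius, homCoord, IsFractionRing.ringEquivOfRingEquiv_algebraMap,
    Ideal.quotientEquiv_mk]
  simp [polyFrobenius]

theorem coneFrobenius_algebraMap (c : AlgebraicClosure F) :
    C.coneFrobenius (algebraMap (AlgebraicClosure F) C.ConeField c) =
      algebraMap (AlgebraicClosure F) C.ConeField (c ^ Fintype.card F) := by
  have h : ∀ c : AlgebraicClosure F, algebraMap (AlgebraicClosure F) C.ConeField c =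
      algebraMap C.CoordRing C.ConeField (Ideal.Quotient.mk C.ideal (MvPolynomial.C c)) :=
    fun c => rfl
  rw [h, h, coneFrobenius, IsFractionRing.ringEquivOfRingEquiv_algebraMap,
    Ideal.quotientEquiv_mk]
  simp [polyFrobenius]

theorem coneFrobenius_mem (z : C.functionField) :
    C.coneFrobenius (z : C.ConeField) ∈ C.functionField := by
  obtain ⟨z, hz⟩ := z
  refine IntermediateField.adjoin_induction (AlgebraicClosure F)
    (p := fun z _ => C.coneFrobenius z ∈ C.functionField) ?_ ?_ ?_ ?_ ?_ hz
  · rintro _ ⟨i, j, rfl⟩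
    rw [map_div₀, coneFrobenius_homCoord, coneFrobenius_homCoord]
    exact IntermediateField.subset_adjoin _ _ ⟨i, j, rfl⟩
  · intro c
    rw [coneFrobenius_algebraMap]
    exact C.functionField.algebraMap_mem _
  · intro x y _ _ hx hy
    rw [RingEquiv.map_add]
    exact add_mem hx hy
  · intro x _ hx
    rw [map_inv₀]
    exact inv_mem hx
  · intro x y _ _ hx hy
    rw [RingEquiv.map_mul]
    exact mul_mem hx hy

/-- The Frobenius of the function field over the algebraic closure: it fixes the function
field over `F` and raises the constants to the power `q`. -/
def frobenius : C.functionField →+* C.functionField :=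
  ((C.coneFrobenius : C.ConeField →+* C.ConeField).comp
    (algebraMap C.functionField C.ConeField)).codRestrict C.functionField C.coneFrobenius_mem

/-- The set of points of the nonsingular model that are rational over the extension of degree
`r` of `F`: the points fixed by the `r`-th power of the Frobenius. -/
def rationalPoints (r : ℕ) : Set C.Point :=
  {P | P.ring.comap (C.frobenius ^ r) = P.ring}

/-- The number `N_r` of points of the nonsingular model that are rational over the extension of
degree `r` of `F`. -/
def numPoints (r : ℕ) : ℕ := (C.rationalPoints r).ncard

end Frobenius

end PlaneCurve

end

/-! The proof is a double count. Sum the intersection multiplicity at `P` of the curve with the line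
`a` over all nonzero linear forms `a` over `F` and all points `P` rational over the quadratic
extension.

For a fixed line, the multiplicities add up to at most `d` (`sum_mult_le`). Dividing its form by
that of a line avoiding the chosen points gives a function `t` whose zeros there are these
multiplicities. The number of zeros is at most `[K : k(t)]`, which is at most `d` because the
equation of the curve, dehomogenized, has degree at most `d` in the remaining coordinate. So the
total is at most `(q³ - 1) d = (q - 1) d (q² + q + 1)`.

For a fixed `P`, rationality puts residues of quotients of forms over `F` in the field of definition
of `P`. If `P` is rational over `F`, successive subtraction of residues gives a basis of forms over
`F` realizing the three orders `0 < j₁ < j₂`, so `P` contributes exactly `(q - 1)(q j₁ + j₂)`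
(`sum_mult_baseChange_eq`). If `P` is rational only over the quadratic extension, the `q³` forms
have at most `q²` residues, so some line over `F` passes through `P`; its scalar multiples
contribute at least `q - 1` (`le_sum_mult_baseChange`). Comparing and cancelling `q - 1` gives the
bound. -/

open WithZero IntermediateField

open scoped IntermediateField.algebraAdjoinAdjoin

/-! ### Zeros of a function `t` against the degree over `k(t)` -/

section FundamentalInequality

variable {k K ι : Type*} [Field k] [Field K] [Algebra k K]

theorem Valuation.map_aeval_le_one (v : Valuation K ℤᵐ⁰)
    (hk : ∀ c : k, v (algebraMap k K c) ≤ 1) {t : K} (ht : v t ≤ 1) (p : Polynomial k) :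
    v (Polynomial.aeval t p) ≤ 1 := by
  rw [Polynomial.aeval_eq_sum_range]
  refine v.map_sum_le fun i _ => ?_
  rw [Algebra.smul_def, map_mul, map_pow]
  exact mul_le_one' (hk _) (pow_le_one' ht _)

theorem Valuation.map_algebraMap_eq_one (v : Valuation K ℤᵐ⁰)
    (hk : ∀ c : k, v (algebraMap k K c) ≤ 1) {c : k} (hc : c ≠ 0) :
    v (algebraMap k K c) = 1 := by
  refine le_antisymm (hk c) ?_
  have h := hk c⁻¹
  rw [map_inv₀, map_inv₀] at h
  exact (inv_le_one₀ (by simpa [zero_lt_iff] using hc)).1 h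

/-- If `a` is large at `i` and small at every other place, then `a / (1 + a)` is a unit at `i` and
has positive order elsewhere. A high power of it repairs `π ^ r` at the other places without
changing its order at `i`. -/
theorem Valuation.exists_eq_exp_neg_and_le [Finite ι] (v : ι → Valuation K ℤᵐ⁰)
    (hsep : ∀ i, ∃ a, 1 < v i a ∧ ∀ j ≠ i, v j a < 1) (hπ : ∀ i, ∃ π, v i π = exp (-1 : ℤ))
    (n : ι → ℕ) (i : ι) (r : ℕ) :
    ∃ b, v i b = exp (-(r : ℤ)) ∧ ∀ j ≠ i, v j b ≤ exp (-(n j : ℤ)) := by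
  obtain ⟨a, ha, haj⟩ := hsep i
  obtain ⟨π, hπ⟩ := hπ i
  have hπ0 : π ≠ 0 := by
    rintro rfl
    exact exp_ne_zero (hπ.symm.trans (map_zero _))
  have h1 : v i (a / (1 + a)) = 1 := by
    have : v i (1 + a) = v i a := (v i).map_add_eq_of_lt_right (by simpa using ha)
    rw [map_div₀, this, div_self (zero_lt_one.trans ha).ne']
  have h2 : ∀ j ≠ i, v j (a / (1 + a)) ≤ exp (-1 : ℤ) := fun j hj => by
    rw [map_div₀, (v j).map_one_add_of_lt (haj j hj), div_one]
    have := haj j hj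
    by_cases h0 : v j a = 0
    · simp [h0]
    · rw [← exp_log h0, ← exp_zero, exp_lt_exp] at this
      rw [← exp_log h0, exp_le_exp]
      omega
  have h3 : ∀ j, ∃ m : ℕ, ∀ M ≥ m, j ≠ i → v j ((a / (1 + a)) ^ M * π ^ r) ≤ exp (-(n j : ℤ)) := by
    intro j
    have h0 : v j π ≠ 0 := by simpa using hπ0
    refine ⟨(r * log (v j π) + n j).toNat, fun M hM hj => ?_⟩
    rw [map_mul, map_pow, map_pow]
    calc v j (a / (1 + a)) ^ M * v j π ^ r
        ≤ exp (-1 : ℤ) ^ M * exp (log (v j π)) ^ r := by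
          rw [exp_log h0]
          gcongr
          exact h2 j hj
      _ = exp (-(M : ℤ) + r * log (v j π)) := by
          rw [← exp_nsmul, ← exp_nsmul, ← exp_add]
          simp
      _ ≤ _ := by
          rw [exp_le_exp]
          have := Int.self_le_toNat (r * log (v j π) + n j)
          omega
  choose m hm using h3
  obtain ⟨M, hM⟩ := Finite.exists_le m
  refine ⟨(a / (1 + a)) ^ M * π ^ r, ?_, fun j hj => hm j M (hM j) hj⟩
  rw [map_mul, map_pow, map_pow, h1, hπ, one_pow, one_mul, ← exp_nsmul]
  simp

/-- At the place `i`, a nonzero constant coefficient at the least possible `r` would give a term of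
order exactly `r`. Every other term has larger order: those from other places by the choice of `b`,
those with smaller index because their constant coefficient already vanishes and `t` has order `n i
> r`. Such a sum cannot be zero. -/
theorem coeff_zero_eq_zero_of_sum_eq_zero [Fintype ι] (v : ι → Valuation K ℤᵐ⁰)
    (hk : ∀ i, ∀ c : k, v i (algebraMap k K c) ≤ 1) {t : K} (n : ι → ℕ)
    (hn : ∀ i, v i t = exp (-(n i : ℤ))) (b : (Σ i, Fin (n i)) → K)
    (hb : ∀ x, v x.1 (b x) = exp (-(x.2 : ℤ)))
    (hb' : ∀ x, ∀ j ≠ x.1, v j (b x) ≤ exp (-(n j : ℤ)))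
    (p : (Σ i, Fin (n i)) → Polynomial k) (hp : ∑ x, Polynomial.aeval t (p x) * b x = 0)
    (x : Σ i, Fin (n i)) : (p x).coeff 0 = 0 := by
  classical
  obtain ⟨i, r⟩ := x
  induction r using WellFoundedLT.induction with
  | ind r ih =>
    by_contra hc
    have hni : (0 : ℤ) < n i := by have := r.pos; omega
    have hti : v i t < 1 := by
      rw [hn, ← exp_zero, exp_lt_exp]
      omega
    have hsplit : ∀ q : Polynomial k, Polynomial.aeval t q =
        t * Polynomial.aeval t q.divX + algebraMap k K (q.coeff 0) := fun q => by
      conv_lhs => rw [← Polynomial.X_mul_divX_add q]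
      rw [map_add, map_mul, Polynomial.aeval_X, Polynomial.aeval_C]
    have hlt : ∀ q : Polynomial k, v i (t * Polynomial.aeval t q) ≤ exp (-(n i : ℤ)) := fun q => by
      rw [map_mul, hn]
      exact mul_le_of_le_one_right' ((v i).map_aeval_le_one (hk i) hti.le q)
    have hlt1 : exp (-(n i : ℤ)) < exp (-(r : ℤ)) := by
      rw [exp_lt_exp]
      have := r.2
      omega
    have hmain : v i (Polynomial.aeval t (p ⟨i, r⟩) * b ⟨i, r⟩) = exp (-(r : ℤ)) := by
      rw [map_mul, hb ⟨i, r⟩, hsplit, Valuation.map_add_eq_of_lt_right,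
        (v i).map_algebraMap_eq_one (hk i) hc, one_mul]
      rw [(v i).map_algebraMap_eq_one (hk i) hc]
      refine (hlt _).trans_lt ?_
      rw [← exp_zero, exp_lt_exp]
      omega
    have hsum := Valuation.map_sum_eq_of_lt (v i) (s := Finset.univ)
      (f := fun x => Polynomial.aeval t (p x) * b x) (j := ⟨i, r⟩) (Finset.mem_univ _) ?_
    · rw [hp, hmain] at hsum
      exact exp_ne_zero (hsum.symm.trans (map_zero _))
    · rintro ⟨j, s⟩ hx
      simp only [hmain]
      simp only [Finset.mem_sdiff, Finset.mem_univ, Finset.mem_singleton, true_and] at hx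
      by_cases hij : j = i
      · subst hij
        rcases lt_trichotomy s r with h | h | h
        · rw [hsplit, ih s h, map_zero, add_zero, map_mul]
          refine lt_of_le_of_lt (mul_le_of_le_one_right' ?_) ((hlt _).trans_lt hlt1)
          rw [hb ⟨j, s⟩, ← exp_zero, exp_le_exp]
          simp
        · exact absurd (by rw [h]) hx
        · rw [map_mul, hb ⟨j, s⟩]
          refine lt_of_le_of_lt (mul_le_of_le_one_left'
            ((v j).map_aeval_le_one (hk j) hti.le _)) ?_
          rw [exp_lt_exp]
          have : (r : ℕ) < s := h
          simp only
          omega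
      · rw [map_mul]
        refine lt_of_le_of_lt (mul_le_of_le_one_left' ((v i).map_aeval_le_one (hk i) hti.le _)) ?_
        exact (hb' ⟨j, s⟩ i (Ne.symm hij)).trans_lt hlt1

/-- The zeros of a function `t`, counted with multiplicity, number at most `[K : k(t)]`. -/
theorem sum_le_finrank_of_valuation_eq [Fintype ι] (v : ι → Valuation K ℤᵐ⁰)
    (hk : ∀ i, ∀ c : k, v i (algebraMap k K c) ≤ 1)
    (hsep : ∀ i, ∃ a, 1 < v i a ∧ ∀ j ≠ i, v j a < 1) (hπ : ∀ i, ∃ π, v i π = exp (-1 : ℤ))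
    (t : K) (n : ι → ℕ) (hn : ∀ i, v i t = exp (-(n i : ℤ))) [FiniteDimensional k⟮t⟯ K] :
    ∑ i, n i ≤ Module.finrank k⟮t⟯ K := by
  classical
  rcases isEmpty_or_nonempty ι with h | ⟨⟨i₀⟩⟩
  · simp
  have ht0 : t ≠ 0 := by
    rintro rfl
    exact exp_ne_zero ((hn i₀).symm.trans (map_zero _))
  choose b hb hb' using fun x : Σ i, Fin (n i) =>
    Valuation.exists_eq_exp_neg_and_le v hsep hπ n x.1 x.2
  -- Once all constant coefficients vanish, the relation can be divided by `t`, which lowers every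
  -- coefficient index by one.
  have hcoeff : ∀ N : ℕ, ∀ p : (Σ i, Fin (n i)) → Polynomial k,
      ∑ x, Polynomial.aeval t (p x) * b x = 0 → ∀ x, (p x).coeff N = 0 := by
    intro N
    induction N with
    | zero => exact fun p hp => coeff_zero_eq_zero_of_sum_eq_zero v hk n hn b hb hb' p hp
    | succ N ih =>
      intro p hp x
      have h0 := coeff_zero_eq_zero_of_sum_eq_zero v hk n hn b hb hb' p hp
      rw [← Polynomial.coeff_divX]
      refine ih (fun x => (p x).divX) (mul_left_cancel₀ ht0 ?_) x
      rw [mul_zero, ← hp, Finset.mul_sum]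
      refine Finset.sum_congr rfl fun y _ => ?_
      conv_rhs => rw [← Polynomial.X_mul_divX_add (p y), h0 y]
      simp [mul_assoc]
  have hli : LinearIndependent k⟮t⟯ b := by
    -- Clearing denominators reduces independence over `k(t)` to relations with coefficients in
    -- `k[t]`.
    rw [← LinearIndependent.iff_fractionRing (Algebra.adjoin k {t}) k⟮t⟯,
      Fintype.linearIndependent_iff]
    intro g hg x
    have hex : ∀ y, ∃ p : Polynomial k, Polynomial.aeval t p = (g y : K) := fun y =>
      (Algebra.adjoin_singleton_eq_range_aeval k t).le (g y).2
    choose p hp using hex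
    have hp0 : p x = 0 := by
      refine Polynomial.ext fun N => ?_
      rw [Polynomial.coeff_zero]
      refine hcoeff N p ?_ x
      rw [← hg]
      refine Finset.sum_congr rfl fun y _ => ?_
      rw [hp, Algebra.smul_def]
      rfl
    have := hp x
    rw [hp0, map_zero] at this
    exact Subtype.ext this.symm
  have := hli.fintype_card_le_finrank
  simpa using this

end FundamentalInequality

/-! ### Valuations at points, and linear forms as functions -/

noncomputable section

namespace PlaneCurve

variable {F : Type*} [Field F] {d : ℕ} {C : PlaneCurve F d}

namespace Point

/-- The valuation attached to a point, in multiplicative notation. -/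
def val (P : C.Point) : Valuation C.functionField ℤᵐ⁰ :=
  haveI : IsDiscreteValuationRing P.ring := P.dvr
  (IsDiscreteValuationRing.maximalIdeal P.ring).valuation C.functionField

theorem ord_eq (P : C.Point) (z : C.functionField) : P.ord z = -log (P.val z) := rfl

theorem val_le_one_iff (P : C.Point) (z : C.functionField) : P.val z ≤ 1 ↔ z ∈ P.ring := by
  have : IsDiscreteValuationRing P.ring := P.dvr
  constructor
  · intro h
    obtain ⟨a, rfl⟩ := IsDiscreteValuationRing.exists_lift_of_le_one h
    exact a.2
  · intro h
    exact (IsDiscreteValuationRing.maximalIdeal P.ring).valuation_le_one (K := C.functionField)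
      ⟨z, h⟩

theorem val_algebraMap_le_one (P : C.Point) (c : AlgebraicClosure F) :
    P.val (algebraMap (AlgebraicClosure F) C.functionField c) ≤ 1 :=
  (P.val_le_one_iff _).2 (P.const_mem c)

theorem val_smul (P : C.Point) {c : AlgebraicClosure F} (hc : c ≠ 0) (z : C.functionField) :
    P.val (c • z) = P.val z := by
  rw [Algebra.smul_def, map_mul,
    P.val.map_algebraMap_eq_one P.val_algebraMap_le_one hc, one_mul]

theorem val_smul_le (P : C.Point) (c : AlgebraicClosure F) (z : C.functionField) :
    P.val (c • z) ≤ P.val z := by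
  rw [Algebra.smul_def, map_mul]
  exact mul_le_of_le_one_left' (P.val_algebraMap_le_one c)

theorem exists_uniformizer (P : C.Point) : ∃ π, P.val π = exp (-1 : ℤ) :=
  haveI : IsDiscreteValuationRing P.ring := P.dvr
  (IsDiscreteValuationRing.maximalIdeal P.ring).valuation_exists_uniformizer C.functionField

/-- Distinct points have distinct valuation rings, hence inequivalent real absolute values, and the
separation step of weak approximation applies to these. -/
theorem exists_one_lt_val_lt_one {ι : Type*} [Finite ι] (P : ι → C.Point)
    (hP : Function.Injective P) (i : ι) :
    ∃ a, 1 < (P i).val a ∧ ∀ j ≠ i, (P j).val a < 1 := by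
  have key : ∀ P : C.Point, ∃ w : AbsoluteValue C.functionField ℝ,
      ∀ z, w z ≤ 1 ↔ P.val z ≤ 1 := by
    intro P
    have : IsDiscreteValuationRing P.ring := P.dvr
    refine ⟨(IsDiscreteValuationRing.maximalIdeal P.ring).adicAbv one_lt_two, fun z => ?_⟩
    change ((WithZeroMulInt.toNNReal two_ne_zero (P.val z) : NNReal) : ℝ) ≤ 1 ↔ _
    rw [NNReal.coe_le_one, WithZeroMulInt.toNNReal_le_one_iff one_lt_two]
  choose w hw using key
  have hlt : ∀ (P : C.Point) z, 1 < w P z ↔ 1 < P.val z := fun P z => by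
    rw [← not_le, hw, not_le]
  have hlt' : ∀ (P : C.Point) z, w P z < 1 ↔ P.val z < 1 := fun P z => by
    by_cases hz : z = 0
    · simp [hz]
    · have := hlt P z⁻¹
      rwa [map_inv₀, map_inv₀, one_lt_inv₀ (by simpa using hz),
        one_lt_inv₀ (by simpa [zero_lt_iff] using hz)] at this
  have hnontriv : ∀ i, (w (P i)).IsNontrivial := fun i => by
    obtain ⟨π, hπ⟩ := (P i).exists_uniformizer
    refine ⟨π, ?_, ((hlt' _ _).2 ?_).ne⟩
    · rintro rfl
      exact exp_ne_zero (hπ.symm.trans (map_zero _))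
    · rw [hπ, ← exp_zero, exp_lt_exp]
      norm_num
  have hpair : Pairwise fun i j => ¬(w (P i)).IsEquiv (w (P j)) := fun i j hij h => by
    refine hij (hP (Point.ext (ValuationSubring.ext _ _ fun z => ?_)))
    rw [← val_le_one_iff, ← val_le_one_iff, ← hw, ← hw]
    exact h.le_one_iff
  obtain ⟨a, h1, h2⟩ := AbsoluteValue.exists_one_lt_lt_one_pi_of_not_isEquiv hnontriv hpair i
  exact ⟨a, (hlt _ _).1 h1, fun j hj => (hlt' _ _).1 (h2 j hj)⟩

end Point

/-- A form of degree `d > 1` cannot divide a nonzero linear form. This makes the coordinate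
functions linearly independent over the constants. -/
theorem eq_zero_of_mk_eq_zero (hd : 1 < d) (C : PlaneCurve F d) (a : Fin 3 → AlgebraicClosure F)
    (h : Ideal.Quotient.mk C.ideal (∑ i, MvPolynomial.C (a i) * MvPolynomial.X i) = 0) :
    a = 0 := by
  rw [Ideal.Quotient.eq_zero_iff_mem, ideal, Ideal.mem_span_singleton] at h
  by_contra ha
  have hne : (∑ i, MvPolynomial.C (a i) * MvPolynomial.X i :
      MvPolynomial (Fin 3) (AlgebraicClosure F)) ≠ 0 := by
    intro h0
    refine ha (funext fun j => ?_)
    have := congrArg (MvPolynomial.eval (Pi.single j 1)) h0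
    simpa [Pi.single_apply] using this
  have h1 : (∑ i, MvPolynomial.C (a i) * MvPolynomial.X i :
      MvPolynomial (Fin 3) (AlgebraicClosure F)).totalDegree ≤ 1 := by
    refine MvPolynomial.totalDegree_finsetSum_le fun i _ => ?_
    refine (MvPolynomial.totalDegree_mul _ _).trans ?_
    simp
  have h2 : C.geomPoly.totalDegree = d :=
    (C.isHomogeneous.map _).totalDegree C.irreducible.ne_zero
  have := MvPolynomial.totalDegree_le_of_dvd_of_isDomain h hne
  omega

theorem homCoord_ne_zero (hd : 1 < d) (C : PlaneCurve F d) (i : Fin 3) : C.homCoord i ≠ 0 := by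
  intro h
  rw [homCoord, IsFractionRing.to_map_eq_zero_iff] at h
  have := C.eq_zero_of_mk_eq_zero hd (Pi.single i 1) (by simpa [Pi.single_apply] using h)
  simpa using congrFun this i

/-- The function `a₀ f₀ + a₁ f₁ + a₂ f₂` attached to a linear form. -/
def lin (C : PlaneCurve F d) : (Fin 3 → AlgebraicClosure F) →ₗ[AlgebraicClosure F] C.functionField :=
  Fintype.linearCombination (AlgebraicClosure F) C.coord

theorem lin_apply (C : PlaneCurve F d) (a : Fin 3 → AlgebraicClosure F) :
    C.lin a = ∑ i, a i • C.coord i := rfl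

theorem lin_single (C : PlaneCurve F d) (i : Fin 3) : C.lin (Pi.single i 1) = C.coord i := by
  simp [lin_apply, Pi.single_apply]

theorem lin_injective (hd : 1 < d) (C : PlaneCurve F d) : Function.Injective C.lin := by
  rw [injective_iff_map_eq_zero]
  intro a ha
  refine C.eq_zero_of_mk_eq_zero hd a ?_
  rw [← IsFractionRing.to_map_eq_zero_iff (K := C.ConeField)]
  have h : (C.lin a : C.ConeField) * C.homCoord 0 = 0 := by rw [ha]; simp
  rw [lin_apply] at h
  rw [← h, map_sum, map_sum]
  push_cast
  rw [Finset.sum_mul]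
  refine Finset.sum_congr rfl fun i _ => ?_
  rw [smul_mul_assoc, coord]
  simp only
  rw [div_mul_cancel₀ _ (C.homCoord_ne_zero hd 0), Algebra.smul_def, map_mul, map_mul]
  rfl

theorem lin_ne_zero (hd : 1 < d) (C : PlaneCurve F d) {a : Fin 3 → AlgebraicClosure F}
    (ha : a ≠ 0) : C.lin a ≠ 0 :=
  (map_ne_zero_iff _ (C.lin_injective hd)).2 ha

theorem _root_.MvPolynomial.IsHomogeneous.aeval_mul_left {R A σ : Type*} [CommRing R] [CommRing A]
    [Algebra R A] {p : MvPolynomial σ R} {n : ℕ} (hp : p.IsHomogeneous n) (c : A) (x : σ → A) :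
    MvPolynomial.aeval (fun i => c * x i) p = c ^ n * MvPolynomial.aeval x p := by
  rw [MvPolynomial.aeval_def, MvPolynomial.eval₂_eq, MvPolynomial.aeval_def, MvPolynomial.eval₂_eq,
    Finset.mul_sum]
  refine Finset.sum_congr rfl fun m hm => ?_
  have : ∑ i ∈ m.support, m i = n := by
    rw [← hp (MvPolynomial.mem_support_iff.1 hm), Finsupp.weight_apply, Finsupp.sum]
    simp
  simp_rw [mul_pow]
  rw [Finset.prod_mul_distrib, Finset.prod_pow_eq_pow_sum, this]
  ring

theorem isHomogeneous_geomPoly (C : PlaneCurve F d) : C.geomPoly.IsHomogeneous d :=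
  C.isHomogeneous.map _

theorem aeval_coord (C : PlaneCurve F d) :
    MvPolynomial.aeval C.coord C.geomPoly = 0 := by
  apply (algebraMap C.functionField C.ConeField).injective
  rw [map_zero, ← MvPolynomial.aeval_algebraMap_apply]
  have h : (fun i => algebraMap C.functionField C.ConeField (C.coord i)) =
      fun i => (C.homCoord 0)⁻¹ * C.homCoord i := by
    funext i
    change C.homCoord i / C.homCoord 0 = _
    rw [div_eq_inv_mul]
  change MvPolynomial.aeval (fun i => algebraMap C.functionField C.ConeField (C.coord i)) _ = 0
  rw [h, C.isHomogeneous_geomPoly.aeval_mul_left]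
  have : MvPolynomial.aeval C.homCoord C.geomPoly =
      algebraMap C.CoordRing C.ConeField (Ideal.Quotient.mk C.ideal C.geomPoly) := by
    have : (MvPolynomial.aeval C.homCoord : _ →ₐ[AlgebraicClosure F] C.ConeField) =
      (IsScalarTower.toAlgHom (AlgebraicClosure F) C.CoordRing C.ConeField).comp
        (Ideal.Quotient.mkₐ (AlgebraicClosure F) C.ideal) := by
      ext i
      simp [homCoord]
    rw [this]
    rfl
  have h0 : C.geomPoly ∈ C.ideal := Ideal.mem_span_singleton_self _
  rw [this, Ideal.Quotient.eq_zero_iff_mem.2 h0, map_zero, mul_zero]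

theorem adjoin_coord (hd : 1 < d) (C : PlaneCurve F d) :
    IntermediateField.adjoin (AlgebraicClosure F) (Set.range C.coord) = ⊤ := by
  rw [eq_top_iff]
  rintro ⟨z, hz⟩ -
  set E := IntermediateField.adjoin (AlgebraicClosure F) (Set.range C.coord)
  have hE : ∀ i j, C.coord i / C.coord j ∈ E := fun i j =>
    div_mem (subset_adjoin _ _ ⟨i, rfl⟩) (subset_adjoin _ _ ⟨j, rfl⟩)
  have h : C.functionField ≤ lift E := by
    conv_lhs => rw [functionField]
    rw [adjoin_le_iff]
    rintro _ ⟨i, j, rfl⟩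
    have h0 := C.homCoord_ne_zero hd 0
    have : C.homCoord i / C.homCoord j = ((C.coord i / C.coord j : C.functionField) : C.ConeField) := by
      push_cast
      change _ = (C.homCoord i / C.homCoord 0) / (C.homCoord j / C.homCoord 0)
      rw [div_div_div_cancel_right₀ h0]
    rw [this]
    exact (mem_lift _).2 (hE i j)
  exact (mem_lift (⟨z, hz⟩ : C.functionField)).1 (h hz)

end PlaneCurve
end

/-! ### The function field has degree at most `d` over a quotient of two linear forms -/

noncomputable section

/-- Since `t` is transcendental, `p` stays nonzero over `k(t)`. It is then a multiple of the minimal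
polynomial of `y`, and `y` generates `K` over `k(t)`. -/
theorem finrank_adjoin_simple_le {k K : Type*} [Field k] [Field K] [Algebra k K] {t : K}
    (ht : Transcendental k t) (y : K) (htop : adjoin k {t, y} = ⊤)
    {p : Polynomial (Polynomial k)} (hp : p ≠ 0)
    (hpy : p.eval₂ (Polynomial.aeval t : _ →ₐ[k] K).toRingHom y = 0) :
    FiniteDimensional k⟮t⟯ K ∧ Module.finrank k⟮t⟯ K ≤ p.natDegree := by
  let τ := AdjoinSimple.gen k t
  let ψ : Polynomial k →ₐ[k] k⟮t⟯ := Polynomial.aeval τ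
  have hψ : Function.Injective ψ := by
    rw [← transcendental_iff_injective]
    intro h
    exact ht (by simpa [τ] using h.algebraMap (A := K))
  have hp0 : p.map ψ.toRingHom ≠ 0 := (Polynomial.map_ne_zero_iff hψ).2 hp
  have hpy : Polynomial.aeval y (p.map ψ.toRingHom) = 0 := by
    rw [Polynomial.aeval_def, Polynomial.eval₂_map, ← hpy]
    congr 1
    ext
    · simp [ψ, ← IsScalarTower.algebraMap_apply]
    · simp [ψ, τ]
  have hint : IsIntegral k⟮t⟯ y := (show IsAlgebraic _ _ from ⟨_, hp0, hpy⟩).isIntegral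
  have htop' : k⟮t⟯⟮y⟯ = ⊤ := by
    rw [← restrictScalars_eq_top_iff (K := k), adjoin_simple_adjoin_simple, htop]
  have hfd : FiniteDimensional k⟮t⟯ k⟮t⟯⟮y⟯ := adjoin.finiteDimensional hint
  have hrank := adjoin.finrank hint
  rw [htop'] at hfd hrank
  rw [finrank_top'] at hrank
  refine ⟨topEquiv.toLinearEquiv.finiteDimensional, ?_⟩
  rw [hrank]
  exact (Polynomial.natDegree_le_of_dvd (minpoly.dvd _ _ hpy) hp0).trans Polynomial.natDegree_map_le

namespace PlaneCurve

variable {F : Type*} [Field F] {d : ℕ} {C : PlaneCurve F d}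

theorem coord_eq_sum (C : PlaneCurve F d) {M : Matrix (Fin 3) (Fin 3) (AlgebraicClosure F)}
    (hM : IsUnit M) (i : Fin 3) : C.coord i = ∑ j, M⁻¹ i j • C.lin (M j) := by
  have h : ∑ j, M⁻¹ i j • M j = Pi.single i 1 := by
    have h1 : M⁻¹ * M = 1 := Matrix.nonsing_inv_mul M ((Matrix.isUnit_iff_isUnit_det M).1 hM)
    funext l
    have := congrFun (congrFun h1 i) l
    rw [Matrix.mul_apply] at this
    rw [Finset.sum_apply, Pi.single_apply]
    simpa [Matrix.one_apply, eq_comm] using this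
  rw [← C.lin_single, ← h, map_sum]
  simp

/-- An algebraic quotient would be a constant, as the constants are algebraically closed, and would
make `a` and `b` proportional. -/
theorem transcendental_lin_div_lin (hd : 1 < d) (C : PlaneCurve F d)
    {a b : Fin 3 → AlgebraicClosure F} (hab : LinearIndependent (AlgebraicClosure F) ![a, b]) :
    Transcendental (AlgebraicClosure F) (C.lin a / C.lin b) := by
  intro h
  obtain ⟨c, hc⟩ := minpoly.mem_range_of_degree_eq_one (AlgebraicClosure F) _
    (IsAlgClosed.degree_eq_one_of_irreducible (AlgebraicClosure F)
      (minpoly.irreducible h.isIntegral))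
  have hb : C.lin b ≠ 0 := C.lin_ne_zero hd (hab.ne_zero 1)
  rw [eq_div_iff hb] at hc
  change algebraMap (AlgebraicClosure F) C.functionField c * C.lin b = C.lin a at hc
  rw [← Algebra.smul_def, ← map_smul] at hc
  have := LinearIndependent.pair_iff.1 hab 1 (-c) (by
    rw [← C.lin_injective hd hc]
    simp)
  exact one_ne_zero this.1

theorem exists_isUnit_of_linearIndependent {k : Type*} [Field k] {a b : Fin 3 → k}
    (hab : LinearIndependent k ![a, b]) :
    ∃ M : Matrix (Fin 3) (Fin 3) k, IsUnit M ∧ M 0 = a ∧ M 1 = b := by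
  obtain ⟨c, hc⟩ := exists_linearIndependent_snoc_of_lt_finrank hab (by simp)
  exact ⟨Fin.snoc ![a, b] c, Matrix.linearIndependent_rows_iff_isUnit.1 hc, rfl, rfl⟩

/-- The equation of the curve in the affine chart given by the coordinates `M 0`, `M 1`, `M 2`, with
the line `M 1` at infinity. -/
def affineEquation (C : PlaneCurve F d) (M : Matrix (Fin 3) (Fin 3) (AlgebraicClosure F)) :
    Polynomial (Polynomial (AlgebraicClosure F)) :=
  MvPolynomial.aeval (fun i => Polynomial.C (Polynomial.C (M⁻¹ i 0) * Polynomial.X +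
    Polynomial.C (M⁻¹ i 1)) + Polynomial.C (Polynomial.C (M⁻¹ i 2)) * Polynomial.X) C.geomPoly

theorem natDegree_affineEquation_le (C : PlaneCurve F d)
    (M : Matrix (Fin 3) (Fin 3) (AlgebraicClosure F)) : (C.affineEquation M).natDegree ≤ d := by
  rw [affineEquation, ← MvPolynomial.aeval_map_algebraMap (Polynomial (AlgebraicClosure F))]
  refine (MvPolynomial.aeval_natDegree_le (m := d) (n := 1) _ ?_ _ fun i => ?_).trans (by simp)
  · exact (C.isHomogeneous_geomPoly.map _).totalDegree_le
  · compute_degree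

theorem eval₂_affineEquation (C : PlaneCurve F d)
    (M : Matrix (Fin 3) (Fin 3) (AlgebraicClosure F)) {A : Type*} [CommRing A]
    [Algebra (AlgebraicClosure F) A] (t y : A) :
    (C.affineEquation M).eval₂ (Polynomial.aeval t : _ →ₐ[AlgebraicClosure F] _).toRingHom y =
      MvPolynomial.aeval (fun i => algebraMap _ A (M⁻¹ i 0) * t + algebraMap _ A (M⁻¹ i 1) +
        algebraMap _ A (M⁻¹ i 2) * y) C.geomPoly := by
  let φ : Polynomial (Polynomial (AlgebraicClosure F)) →ₐ[AlgebraicClosure F] A :=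
    Polynomial.eval₂AlgHom (Polynomial.aeval t) y (fun _ => mul_comm _ _)
  change φ (C.affineEquation M) = _
  rw [affineEquation, MvPolynomial.comp_aeval_apply]
  congr 2
  funext i
  change Polynomial.eval₂ (Polynomial.aeval t : _ →ₐ[AlgebraicClosure F] A).toRingHom y _ = _
  simp

/-- Otherwise the form of the curve vanishes at every point off the line `M 1`. Its product with
that linear form then vanishes everywhere, so one of the two factors is zero. -/
theorem affineEquation_ne_zero (C : PlaneCurve F d)
    {M : Matrix (Fin 3) (Fin 3) (AlgebraicClosure F)} (hM : IsUnit M) :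
    C.affineEquation M ≠ 0 := by
  intro h
  have h1 : ∀ s u : AlgebraicClosure F,
      MvPolynomial.aeval (fun i => M⁻¹ i 0 * s + M⁻¹ i 1 + M⁻¹ i 2 * u) C.geomPoly = 0 := by
    intro s u
    have := C.eval₂_affineEquation M s u
    rw [h, Polynomial.eval₂_zero] at this
    exact this.symm
  have hM0 : ∀ x : Fin 3 → AlgebraicClosure F, ∀ i, x i = ∑ j, M⁻¹ i j * (M.mulVec x) j := by
    intro x i
    have : (M⁻¹).mulVec (M.mulVec x) = x := by
      rw [Matrix.mulVec_mulVec,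
        Matrix.nonsing_inv_mul M ((Matrix.isUnit_iff_isUnit_det M).1 hM), Matrix.one_mulVec]
    exact (congrFun this i).symm
  have h3 : C.geomPoly * ∑ i, MvPolynomial.C (M 1 i) * MvPolynomial.X i = 0 := by
    refine MvPolynomial.funext fun x => ?_
    rw [map_mul, map_zero, mul_eq_zero, or_iff_not_imp_right]
    intro hx
    have hx : (M.mulVec x) 1 ≠ 0 := by
      simpa [Matrix.mulVec, dotProduct] using hx
    have h4 := C.isHomogeneous_geomPoly.aeval_mul_left ((M.mulVec x) 1)
      (fun i => M⁻¹ i 0 * ((M.mulVec x) 0 / (M.mulVec x) 1) + M⁻¹ i 1 +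
        M⁻¹ i 2 * ((M.mulVec x) 2 / (M.mulVec x) 1))
    rw [h1, mul_zero] at h4
    rw [← h4, MvPolynomial.aeval_eq_eval]
    congr 1
    congr 1
    funext i
    rw [hM0 x i, Fin.sum_univ_three]
    field_simp
  rcases mul_eq_zero.1 h3 with h4 | h4
  · exact C.irreducible.ne_zero h4
  · have hrow : M 1 ≠ 0 := (Matrix.linearIndependent_rows_iff_isUnit.2 hM).ne_zero 1
    refine hrow (funext fun j => ?_)
    have := congrArg (MvPolynomial.eval (Pi.single j 1)) h4
    simpa [Pi.single_apply] using this

theorem finrank_adjoin_lin_div_lin_le (hd : 1 < d) (C : PlaneCurve F d)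
    {a b : Fin 3 → AlgebraicClosure F} (hab : LinearIndependent (AlgebraicClosure F) ![a, b]) :
    FiniteDimensional (AlgebraicClosure F)⟮C.lin a / C.lin b⟯ C.functionField ∧
      Module.finrank (AlgebraicClosure F)⟮C.lin a / C.lin b⟯ C.functionField ≤ d := by
  have htr := C.transcendental_lin_div_lin hd hab
  obtain ⟨M, hM, rfl, rfl⟩ := exists_isUnit_of_linearIndependent hab
  have hb : C.lin (M 1) ≠ 0 := C.lin_ne_zero hd (hab.ne_zero 1)
  set t := C.lin (M 0) / C.lin (M 1) with ht
  set y := C.lin (M 2) / C.lin (M 1) with hy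
  have hg : ∀ i, (C.lin (M 1))⁻¹ * C.coord i =
      algebraMap _ _ (M⁻¹ i 0) * t + algebraMap _ _ (M⁻¹ i 1) + algebraMap _ _ (M⁻¹ i 2) * y := by
    intro i
    rw [C.coord_eq_sum hM i, Fin.sum_univ_three, ht, hy]
    simp only [Algebra.smul_def]
    field_simp
  have htop : adjoin (AlgebraicClosure F) {t, y} = ⊤ := by
    rw [eq_top_iff, ← C.adjoin_coord hd, adjoin_le_iff]
    have hty : ∀ i, (C.lin (M 1))⁻¹ * C.coord i ∈ adjoin (AlgebraicClosure F) {t, y} := fun i => by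
      rw [hg]
      exact add_mem (add_mem (mul_mem (IntermediateField.algebraMap_mem _ _) (subset_adjoin _ _ (by simp)))
        (IntermediateField.algebraMap_mem _ _)) (mul_mem (IntermediateField.algebraMap_mem _ _) (subset_adjoin _ _ (by simp)))
    have h0 : C.coord 0 = 1 := Subtype.ext (div_self (C.homCoord_ne_zero hd 0))
    rintro _ ⟨i, rfl⟩
    have : C.coord i = ((C.lin (M 1))⁻¹ * C.coord i) / ((C.lin (M 1))⁻¹ * C.coord 0) := by
      rw [h0]
      field_simp
    rw [this]
    exact div_mem (hty i) (hty 0)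
  have hpy : (C.affineEquation M).eval₂ (Polynomial.aeval t : _ →ₐ[AlgebraicClosure F] _).toRingHom
      y = 0 := by
    rw [eval₂_affineEquation]
    simp_rw [← hg]
    rw [C.isHomogeneous_geomPoly.aeval_mul_left, C.aeval_coord, mul_zero]
  obtain ⟨h1, h2⟩ := finrank_adjoin_simple_le htr y htop (C.affineEquation_ne_zero hM) hpy
  exact ⟨h1, h2.trans (C.natDegree_affineEquation_le M)⟩

end PlaneCurve
end

/-! ### Residues, multiplicities and the intersection bound for lines -/

noncomputable section

/-- The residue field of a place of an algebraic function field of one variable over an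
algebraically closed field consists of constants. -/
theorem Valuation.exists_map_sub_algebraMap_lt_one {k K : Type*} [Field k] [IsAlgClosed k]
    [Field K] [Algebra k K] (v : Valuation K ℤᵐ⁰) (hk : ∀ c : k, v (algebraMap k K c) ≤ 1)
    (hπ : ∃ π, v π = exp (-1 : ℤ)) {t : K} [FiniteDimensional k⟮t⟯ K] (ht : v t ≤ 1) :
    ∃ c : k, v (t - algebraMap k K c) < 1 := by
  -- If no constant is a residue of `t`, every nonzero polynomial in `t` is a unit, so `k(t)` lies
  -- in the valuation ring. That ring is integrally closed and `K` is algebraic over `k(t)`, so it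
  -- would contain `π⁻¹`.
  by_contra! hcon
  have htc : ∀ c, v (t - algebraMap k K c) = 1 := fun c =>
    le_antisymm (v.map_sub_le ht (hk c)) (hcon c)
  have hpoly : ∀ p : Polynomial k, p ≠ 0 → v (Polynomial.aeval t p) = 1 := by
    intro p hp
    have hs := (IsAlgClosed.splits p).eq_prod_roots
    rw [hs, map_mul, map_mul, Polynomial.aeval_C,
      v.map_algebraMap_eq_one hk (Polynomial.leadingCoeff_ne_zero.2 hp),
      one_mul, map_multiset_prod, map_multiset_prod, Multiset.map_map, Multiset.map_map]
    refine Multiset.prod_eq_one fun x hx => ?_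
    obtain ⟨c, -, rfl⟩ := Multiset.mem_map.1 hx
    simpa using htc c
  have hadj : ∀ z : k⟮t⟯, (z : K) ∈ v.integer := by
    intro z
    obtain ⟨r, s, hz⟩ := (mem_adjoin_simple_iff _ _).1 z.2
    rw [hz, v.mem_integer_iff, map_div₀]
    by_cases hs : s = 0
    · simp [hs]
    by_cases hr : r = 0
    · simp [hr]
    rw [hpoly r hr, hpoly s hs, div_one]
  obtain ⟨π, hπ⟩ := hπ
  have hint : IsIntegral k⟮t⟯ π⁻¹ := Algebra.IsIntegral.isIntegral _
  have hint' : IsIntegral v.integer π⁻¹ :=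
    hint.map_of_comp_eq ((algebraMap k⟮t⟯ K).codRestrict v.integer hadj) (RingHom.id _) rfl
  have hmem := (Valuation.integer.integers v).mem_of_integral hint'
  rw [v.mem_integer_iff, map_inv₀, hπ, ← exp_neg, ← exp_zero, exp_le_exp] at hmem
  norm_num at hmem

namespace PlaneCurve

variable {F : Type*} [Field F] {d : ℕ} {C : PlaneCurve F d}

theorem coord_ne_zero (hd : 1 < d) (C : PlaneCurve F d) (i : Fin 3) : C.coord i ≠ 0 := by
  rw [← C.lin_single]
  exact C.lin_ne_zero hd (by simp)

namespace Point

/-- The multiplicity at `P` of the divisor cut out on the curve by the line `a`. -/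
def mult (P : C.Point) (a : Fin 3 → AlgebraicClosure F) : ℤ := P.ord (C.lin a) + P.e

theorem isOrder_iff (P : C.Point) (j : ℕ) : P.IsOrder j ↔ ∃ a ≠ 0, (j : ℤ) = P.mult a := Iff.rfl

theorem val_ne_zero (P : C.Point) {z : C.functionField} (hz : z ≠ 0) : P.val z ≠ 0 := by
  simpa using hz

theorem val_lt_one_iff (P : C.Point) {z : C.functionField} (hz : z ≠ 0) :
    P.val z < 1 ↔ z⁻¹ ∉ P.ring := by
  rw [← val_le_one_iff, not_le, map_inv₀, one_lt_inv₀ (zero_lt_iff.2 (P.val_ne_zero hz))]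

theorem val_lin (hd : 1 < d) (P : C.Point) {a : Fin 3 → AlgebraicClosure F} (ha : a ≠ 0) :
    P.val (C.lin a) = exp (P.e - P.mult a) := by
  rw [mult, ord_eq, ← exp_log (P.val_ne_zero (C.lin_ne_zero hd ha)), log_exp]
  congr 1
  ring

theorem val_coord_le (hd : 1 < d) (P : C.Point) (i : Fin 3) : P.val (C.coord i) ≤ exp P.e := by
  rw [← exp_log (P.val_ne_zero (C.coord_ne_zero hd i)), exp_le_exp]
  have : Finset.univ.inf' Finset.univ_nonempty (fun i : Fin 3 => P.ord (C.coord i)) ≤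
    P.ord (C.coord i) := Finset.inf'_le _ (Finset.mem_univ i)
  rw [ord_eq] at this
  rw [e]
  linarith

theorem exists_val_coord_eq (hd : 1 < d) (P : C.Point) : ∃ i, P.val (C.coord i) = exp P.e := by
  obtain ⟨i, -, hi⟩ := Finset.exists_mem_eq_inf' Finset.univ_nonempty
    (fun i : Fin 3 => P.ord (C.coord i))
  refine ⟨i, ?_⟩
  rw [e, hi, ord_eq, neg_neg, exp_log (P.val_ne_zero (C.coord_ne_zero hd i))]

theorem val_lin_le (hd : 1 < d) (P : C.Point) (a : Fin 3 → AlgebraicClosure F) :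
    P.val (C.lin a) ≤ exp P.e := by
  rw [lin_apply]
  exact P.val.map_sum_le fun i _ => (P.val_smul_le _ _).trans (P.val_coord_le hd i)

theorem mult_nonneg (hd : 1 < d) (P : C.Point) {a : Fin 3 → AlgebraicClosure F} (ha : a ≠ 0) :
    0 ≤ P.mult a := by
  have := P.val_lin_le hd a
  rw [P.val_lin hd ha, exp_le_exp] at this
  linarith

theorem mult_smul (P : C.Point) {c : AlgebraicClosure F} (hc : c ≠ 0)
    (a : Fin 3 → AlgebraicClosure F) : P.mult (c • a) = P.mult a := by
  rw [mult, mult, map_smul, ord_eq, ord_eq, P.val_smul hc]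

/-- The linear forms whose line passes through the image of the point `P`. -/
def linesThrough (P : C.Point) : Submodule (AlgebraicClosure F) (Fin 3 → AlgebraicClosure F) where
  carrier := {a | P.val (C.lin a) < exp P.e}
  add_mem' ha hb := by
    rw [Set.mem_ofPred_eq, map_add]
    exact P.val.map_add_lt ha hb
  zero_mem' := by simp
  smul_mem' c a ha := by
    rw [Set.mem_ofPred_eq, map_smul]
    exact (P.val_smul_le _ _).trans_lt ha

theorem linesThrough_ne_top (hd : 1 < d) (P : C.Point) : P.linesThrough ≠ ⊤ := by
  intro h
  obtain ⟨i, hi⟩ := P.exists_val_coord_eq hd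
  have : Pi.single i 1 ∈ P.linesThrough := h ▸ Submodule.mem_top
  change P.val (C.lin _) < _ at this
  rw [C.lin_single, hi] at this
  exact this.false

/-- The lines through each point form a proper subspace, and a vector space over an infinite field
is not a finite union of proper subspaces. Including `⊥` in the union forces `b ≠ 0`. -/
theorem exists_forall_mult_eq_zero (hd : 1 < d) (S : Finset C.Point) :
    ∃ b : Fin 3 → AlgebraicClosure F, b ≠ 0 ∧ ∀ P ∈ S, P.mult b = 0 := by
  classical
  have h := Subspace.biUnion_ne_univ_of_top_notMem (k := AlgebraicClosure F)
    (E := Fin 3 → AlgebraicClosure F) (s := insert ⊥ (S.image linesThrough)) (by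
      simp only [Finset.mem_insert, Finset.mem_image, not_or, not_exists, not_and]
      exact ⟨top_ne_bot, fun P _ => P.linesThrough_ne_top hd⟩)
  obtain ⟨b, hb⟩ := (Set.ne_univ_iff_exists_notMem _).1 h
  simp only [Finset.mem_insert, Finset.mem_image, Set.mem_iUnion, not_exists] at hb
  have hb0 : b ≠ 0 := fun h0 => hb ⊥ (Or.inl rfl) (by simp [h0])
  refine ⟨b, hb0, fun P hP => ?_⟩
  have h1 : ¬ P.val (C.lin b) < exp P.e := hb _ (Or.inr ⟨P, hP, rfl⟩)
  rw [P.val_lin hd hb0, exp_lt_exp] at h1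
  have := P.mult_nonneg hd hb0
  linarith

/-- A line meets the curve in at most `d` branches, counted with multiplicity. -/
theorem sum_mult_le (hd : 1 < d) (S : Finset C.Point) {a : Fin 3 → AlgebraicClosure F}
    (ha : a ≠ 0) : ∑ P ∈ S, P.mult a ≤ d := by
  obtain ⟨b, hb0, hb⟩ := exists_forall_mult_eq_zero hd S
  by_cases hab : LinearIndependent (AlgebraicClosure F) ![a, b]
  · obtain ⟨h1, h2⟩ := C.finrank_adjoin_lin_div_lin_le hd hab
    -- Because `b` avoids `S`, the order of `t` at each `P ∈ S` is exactly the multiplicity of `a`.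
    have h3 := sum_le_finrank_of_valuation_eq (k := AlgebraicClosure F)
      (fun P : S => P.1.val) (fun P => P.1.val_algebraMap_le_one)
      (exists_one_lt_val_lt_one (fun P : S => P.1) Subtype.val_injective)
      (fun P => P.1.exists_uniformizer) (C.lin a / C.lin b) (fun P => (P.1.mult a).toNat)
      (fun P => by
        rw [map_div₀, P.1.val_lin hd ha, P.1.val_lin hd hb0, hb P.1 P.2, ← exp_sub,
          Int.toNat_of_nonneg (P.1.mult_nonneg hd ha)]
        congr 1
        ring)
    calc ∑ P ∈ S, P.mult a = ∑ P : S, P.1.mult a := (Finset.sum_coe_sort S fun P => P.mult a).symm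
      _ = ((∑ P : S, (P.1.mult a).toNat : ℕ) : ℤ) := by
        rw [Nat.cast_sum]
        exact Finset.sum_congr rfl fun P _ => (Int.toNat_of_nonneg (P.1.mult_nonneg hd ha)).symm
      _ ≤ d := by exact_mod_cast h3.trans h2
  -- Here `a` is proportional to `b`, so its line also misses every point of `S`.
  · rw [LinearIndependent.pair_symm_iff, LinearIndependent.pair_iff' hb0] at hab
    push Not at hab
    obtain ⟨c, rfl⟩ := hab
    have hc : c ≠ 0 := by
      rintro rfl
      simp at ha
    rw [Finset.sum_eq_zero fun P hP => by rw [P.mult_smul hc, hb P hP]]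
    positivity

/-- The residue field at a point consists of constants. -/
theorem exists_val_lin_sub_smul_lt (hd : 1 < d) (P : C.Point) {a b : Fin 3 → AlgebraicClosure F}
    (hb : b ≠ 0) (hab : P.val (C.lin a) ≤ P.val (C.lin b)) :
    ∃ c : AlgebraicClosure F, P.val (C.lin a - c • C.lin b) < P.val (C.lin b) := by
  have hlb := C.lin_ne_zero hd hb
  have hvb : 0 < P.val (C.lin b) := zero_lt_iff.2 (P.val_ne_zero hlb)
  by_cases hli : LinearIndependent (AlgebraicClosure F) ![a, b]
  swap
  · rw [LinearIndependent.pair_symm_iff, LinearIndependent.pair_iff' hb] at hli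
    push Not at hli
    obtain ⟨c, rfl⟩ := hli
    exact ⟨c, by simpa using hvb⟩
  obtain ⟨hfin, -⟩ := C.finrank_adjoin_lin_div_lin_le hd hli
  obtain ⟨c, hc⟩ := P.val.exists_map_sub_algebraMap_lt_one P.val_algebraMap_le_one
    P.exists_uniformizer (t := C.lin a / C.lin b)
    (by rw [map_div₀]; exact div_le_one_of_le₀ hab zero_le)
  refine ⟨c, ?_⟩
  have h1 : C.lin a - c • C.lin b = (C.lin a / C.lin b - algebraMap _ _ c) * C.lin b := by
    rw [Algebra.smul_def]
    field_simp
  rw [h1, map_mul]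
  exact mul_lt_of_lt_one_left hvb hc

end Point
end PlaneCurve
end

/-! ### Frobenius and residues of quotients of forms over `F` -/

noncomputable section

theorem card_roots_X_pow_sub_X_le {k : Type*} [Field k] [DecidableEq k] {n : ℕ} (hn : 1 < n) :
    (Polynomial.X ^ n - Polynomial.X : Polynomial k).roots.toFinset.card ≤ n :=
  (Multiset.toFinset_card_le _).trans
    ((Polynomial.card_roots' _).trans (FiniteField.X_pow_card_sub_X_natDegree_eq k hn).le)

theorem mem_roots_X_pow_sub_X {k : Type*} [Field k] [DecidableEq k] {n : ℕ} (hn : 1 < n) {x : k} :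
    x ∈ (Polynomial.X ^ n - Polynomial.X : Polynomial k).roots.toFinset ↔ x ^ n = x := by
  rw [Multiset.mem_toFinset, Polynomial.mem_roots (FiniteField.X_pow_card_sub_X_ne_zero k hn)]
  simp [sub_eq_zero]

theorem FiniteField.exists_algebraMap_eq_of_pow_card_eq {F k : Type*} [Field F] [Fintype F]
    [Field k] [Algebra F k] {x : k} (hx : x ^ Fintype.card F = x) : ∃ c : F, algebraMap F k c = x := by
  classical
  have hq : 1 < Fintype.card F := Fintype.one_lt_card
  have h : Finset.univ.image (algebraMap F k) =
      (Polynomial.X ^ Fintype.card F - Polynomial.X : Polynomial k).roots.toFinset := by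
    refine Finset.eq_of_subset_of_card_le ?_ ?_
    · intro y hy
      obtain ⟨c, -, rfl⟩ := Finset.mem_image.1 hy
      rw [mem_roots_X_pow_sub_X hq, ← map_pow, FiniteField.pow_card]
    · rw [Finset.card_image_of_injective _ (algebraMap F k).injective]
      exact card_roots_X_pow_sub_X_le hq
  have := (mem_roots_X_pow_sub_X hq).2 hx
  rw [← h] at this
  obtain ⟨c, -, hc⟩ := Finset.mem_image.1 this
  exact ⟨c, hc⟩

namespace PlaneCurve

variable {F : Type*} [Field F] {d : ℕ} {C : PlaneCurve F d}

/-- The extension of scalars of a linear form over `F` to the algebraic closure. -/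
def baseChange : (Fin 3 → F) →ₗ[F] (Fin 3 → AlgebraicClosure F) :=
  (Algebra.linearMap F (AlgebraicClosure F)).compLeft (Fin 3)

theorem baseChange_apply (a : Fin 3 → F) (i : Fin 3) :
    baseChange a i = algebraMap F (AlgebraicClosure F) (a i) := rfl

theorem baseChange_smul (c : F) (a : Fin 3 → F) :
    baseChange (c • a) = algebraMap F (AlgebraicClosure F) c • baseChange a := by
  funext i
  simp [baseChange_apply]

theorem baseChange_injective : Function.Injective (baseChange (F := F)) := fun _ _ h =>
  funext fun i => (algebraMap F (AlgebraicClosure F)).injective (congrFun h i)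

theorem baseChange_ne_zero {a : Fin 3 → F} (ha : a ≠ 0) : baseChange a ≠ 0 :=
  (map_ne_zero_iff _ baseChange_injective).2 ha

theorem baseChange_single (i : Fin 3) : baseChange (Pi.single i (1 : F)) = Pi.single i 1 := by
  funext j
  rw [baseChange_apply, Pi.single_apply, Pi.single_apply]
  split_ifs <;> simp

theorem Point.val_baseChange_smul (P : C.Point) {c : F} (hc : c ≠ 0) (a : Fin 3 → F) :
    P.val (C.lin (baseChange (c • a))) = P.val (C.lin (baseChange a)) := by
  rw [baseChange_smul, map_smul, P.val_smul (by simpa using hc)]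

section Frobenius

variable [Fintype F]

theorem frobenius_coord (C : PlaneCurve F d) (i : Fin 3) : C.frobenius (C.coord i) = C.coord i := by
  refine Subtype.ext ?_
  change C.coneFrobenius (C.homCoord i / C.homCoord 0) = C.homCoord i / C.homCoord 0
  rw [map_div₀, coneFrobenius_homCoord, coneFrobenius_homCoord]

theorem frobenius_algebraMap (C : PlaneCurve F d) (c : AlgebraicClosure F) :
    C.frobenius (algebraMap _ C.functionField c) =
      algebraMap _ C.functionField (c ^ Fintype.card F) :=
  Subtype.ext (C.coneFrobenius_algebraMap c)

theorem frobenius_lin_baseChange (C : PlaneCurve F d) (a : Fin 3 → F) :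
    C.frobenius (C.lin (baseChange a)) = C.lin (baseChange a) := by
  rw [lin_apply, map_sum]
  refine Finset.sum_congr rfl fun i _ => ?_
  rw [Algebra.smul_def, map_mul, frobenius_coord, frobenius_algebraMap, baseChange_apply, ← map_pow,
    FiniteField.pow_card]

theorem frobenius_pow_apply_of_fixed (C : PlaneCurve F d) {z : C.functionField}
    (hz : C.frobenius z = z) (r : ℕ) : (C.frobenius ^ r) z = z := by
  induction r with
  | zero => rfl
  | succ r ih => rw [pow_succ, RingHom.mul_def, RingHom.comp_apply, hz, ih]

theorem frobenius_pow_algebraMap (C : PlaneCurve F d) (c : AlgebraicClosure F) (r : ℕ) :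
    (C.frobenius ^ r) (algebraMap _ C.functionField c) =
      algebraMap _ C.functionField (c ^ Fintype.card F ^ r) := by
  induction r generalizing c with
  | zero => simp
  | succ r ih =>
    rw [pow_succ, RingHom.mul_def, RingHom.comp_apply, frobenius_algebraMap, ih, ← pow_mul,
      pow_succ']

theorem rationalPoints_one_subset (C : PlaneCurve F d) (r : ℕ) :
    C.rationalPoints 1 ⊆ C.rationalPoints r := by
  intro P hP
  change P.ring.comap (C.frobenius ^ 1) = P.ring at hP
  rw [pow_one] at hP
  change P.ring.comap (C.frobenius ^ r) = P.ring
  induction r with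
  | zero => rfl
  | succ r ih =>
    refine ValuationSubring.ext _ _ fun z => ?_
    have h1 := SetLike.ext_iff.1 ih (C.frobenius z)
    have h2 := SetLike.ext_iff.1 hP z
    rw [ValuationSubring.mem_comap] at h1 h2 ⊢
    rw [pow_succ, RingHom.mul_def, RingHom.comp_apply, h1, h2]

namespace Point

theorem val_frobenius_pow_lt_one {P : C.Point} {r : ℕ} (hP : P ∈ C.rationalPoints r)
    {z : C.functionField} (hz : P.val z < 1) : P.val ((C.frobenius ^ r) z) < 1 := by
  by_cases h0 : z = 0
  · simp [h0]
  rw [P.val_lt_one_iff h0] at hz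
  rw [P.val_lt_one_iff ((map_ne_zero _).2 h0), ← map_inv₀]
  change P.ring.comap (C.frobenius ^ r) = P.ring at hP
  rwa [← hP, ValuationSubring.mem_comap] at hz

/-- The power of Frobenius preserves the maximal ideal at `P` and fixes `z`, so `c` and its `q ^
r`-th power are both residues of `z`. -/
theorem pow_card_pow_eq {P : C.Point} {r : ℕ} (hP : P ∈ C.rationalPoints r)
    {z : C.functionField} (hz : C.frobenius z = z) {c : AlgebraicClosure F}
    (hc : P.val (z - algebraMap _ _ c) < 1) : c ^ Fintype.card F ^ r = c := by
  have h := val_frobenius_pow_lt_one hP hc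
  rw [map_sub, C.frobenius_pow_apply_of_fixed hz, frobenius_pow_algebraMap] at h
  have h2 := P.val.map_sub_lt hc h
  rw [sub_sub_sub_cancel_left, ← map_sub] at h2
  by_contra hne
  rw [P.val.map_algebraMap_eq_one P.val_algebraMap_le_one (sub_ne_zero.2 hne)] at h2
  exact h2.false

/-- At a point rational over the extension of degree `r`, the quotient of two linear forms over `F`
has its residue in that extension. -/
theorem exists_val_lin_baseChange_sub_lt (hd : 1 < d) {P : C.Point} {r : ℕ}
    (hP : P ∈ C.rationalPoints r) {u : Fin 3 → F} (hu : u ≠ 0) (w : Fin 3 → F)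
    (h : P.val (C.lin (baseChange w)) ≤ P.val (C.lin (baseChange u))) :
    ∃ c : AlgebraicClosure F, c ^ Fintype.card F ^ r = c ∧
      P.val (C.lin (baseChange w - c • baseChange u)) < P.val (C.lin (baseChange u)) := by
  obtain ⟨c, hc⟩ := P.exists_val_lin_sub_smul_lt hd (baseChange_ne_zero hu) h
  refine ⟨c, ?_, by rwa [map_sub, map_smul]⟩
  have hu0 := C.lin_ne_zero hd (baseChange_ne_zero hu)
  refine pow_card_pow_eq hP (z := C.lin (baseChange w) / C.lin (baseChange u)) ?_ ?_
  · rw [map_div₀, frobenius_lin_baseChange, frobenius_lin_baseChange]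
  · have h1 : C.lin (baseChange w) / C.lin (baseChange u) - algebraMap _ _ c =
        (C.lin (baseChange w) - c • C.lin (baseChange u)) / C.lin (baseChange u) := by
      rw [Algebra.smul_def]
      field_simp
    rw [h1, map_div₀]
    exact (div_lt_one₀ (zero_lt_iff.2 (P.val_ne_zero hu0))).2 hc

theorem exists_val_lin_baseChange_lt (hd : 1 < d) {P : C.Point} (hP : P ∈ C.rationalPoints 1)
    {u : Fin 3 → F} (hu : u ≠ 0) (w : Fin 3 → F)
    (h : P.val (C.lin (baseChange w)) ≤ P.val (C.lin (baseChange u))) :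
    ∃ c : F, P.val (C.lin (baseChange (w - c • u))) < P.val (C.lin (baseChange u)) := by
  obtain ⟨c, hc, hlt⟩ := exists_val_lin_baseChange_sub_lt hd hP hu w h
  rw [pow_one] at hc
  obtain ⟨c, rfl⟩ := FiniteField.exists_algebraMap_eq_of_pow_card_eq hc
  exact ⟨c, by rwa [map_sub, baseChange_smul]⟩

/-- Every point rational over the quadratic extension lies on a line over `F`. -/
theorem exists_one_le_mult (hd : 1 < d) {P : C.Point} (hP : P ∈ C.rationalPoints 2) :
    ∃ a : Fin 3 → F, a ≠ 0 ∧ 1 ≤ P.mult (baseChange a) := by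
  classical
  obtain ⟨i, hi⟩ := P.exists_val_coord_eq hd
  have hu : (Pi.single i (1 : F) : Fin 3 → F) ≠ 0 := by simp
  have hui : P.val (C.lin (baseChange (Pi.single i (1 : F)))) = exp P.e := by
    rw [baseChange_single, C.lin_single, hi]
  choose β hβ hlt using fun w : Fin 3 → F => exists_val_lin_baseChange_sub_lt hd hP hu w
    ((P.val_lin_le hd _).trans hui.ge)
  have hq : 1 < Fintype.card F := Fintype.one_lt_card
  have hq2 : 1 < Fintype.card F ^ 2 := Nat.one_lt_pow two_ne_zero hq
  -- Pigeonhole: `q³` forms, at most `q²` residues. Two forms with the same residue differ by a form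
  -- vanishing at `P`.
  obtain ⟨a, -, b, -, hab, heq⟩ := Finset.exists_ne_map_eq_of_card_lt_of_maps_to
    (s := (Finset.univ : Finset (Fin 3 → F))) (f := β)
    ((card_roots_X_pow_sub_X_le (k := AlgebraicClosure F) hq2).trans_lt (by
      rw [Finset.card_univ, Fintype.card_pi_const]
      exact Nat.pow_lt_pow_right hq (by norm_num)))
    (fun a _ => (mem_roots_X_pow_sub_X hq2).2 (hβ a))
  refine ⟨a - b, sub_ne_zero.2 hab, ?_⟩
  have h1 := P.val.map_sub_lt (hlt a) (hlt b)
  rw [heq, ← map_sub, sub_sub_sub_cancel_right, ← map_sub, hui,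
    P.val_lin hd (baseChange_ne_zero (sub_ne_zero.2 hab)), exp_lt_exp] at h1
  linarith

end Point
end Frobenius
end PlaneCurve
end

/-! ### Contribution of one point, and of one line, to the double sum -/

theorem Valuation.map_add_add_eq_ite {k K : Type*} [Field k] [Field K] [Algebra k K]
    [DecidableEq k] (v : Valuation K ℤᵐ⁰) (hk : ∀ c : k, v (algebraMap k K c) ≤ 1) {x y z : K}
    (hyx : v y < v x) (hzy : v z < v y) (a b c : k) :
    v (a • x + b • y + c • z) =
      if a ≠ 0 then v x else if b ≠ 0 then v y else if c ≠ 0 then v z else 0 := by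
  have hle : ∀ (c : k) (z : K), v (c • z) ≤ v z := fun c z => by
    rw [Algebra.smul_def, map_mul]
    exact mul_le_of_le_one_left' (hk c)
  have heq : ∀ (c : k) (z : K), c ≠ 0 → v (c • z) = v z := fun c z hc => by
    rw [Algebra.smul_def, map_mul, v.map_algebraMap_eq_one hk hc, one_mul]
  split_ifs with ha hb hc
  · have h1 : v (a • x + b • y) = v x := by
      rw [v.map_add_eq_of_lt_left, heq a x ha]
      rw [heq a x ha]
      exact (hle b y).trans_lt hyx
    rw [v.map_add_eq_of_lt_left, h1]
    rw [h1]
    exact (hle c z).trans_lt (hzy.trans hyx)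
  · rw [not_ne_iff.1 ha, zero_smul, zero_add, v.map_add_eq_of_lt_left, heq b y hb]
    rw [heq b y hb]
    exact (hle c z).trans_lt hzy
  · rw [not_ne_iff.1 ha, not_ne_iff.1 hb, zero_smul, zero_add, zero_smul, zero_add, heq c z hc]
  · rw [not_ne_iff.1 ha, not_ne_iff.1 hb, not_ne_iff.1 hc]
    simp

theorem Nat.nth_eq_of_iff {p : ℕ → Prop} {m n : ℕ} (hm : 0 < m) (hmn : m < n)
    (hp : ∀ j, p j ↔ j = 0 ∨ j = m ∨ j = n) : Nat.nth p 1 = m ∧ Nat.nth p 2 = n := by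
  classical
  have h1 : Nat.count p m = 1 := by
    rw [Nat.count_eq_card_filter_range, Finset.card_eq_one]
    refine ⟨0, Finset.ext fun j => ?_⟩
    simp only [Finset.mem_filter, Finset.mem_range, hp, Finset.mem_singleton]
    omega
  have h2 : Nat.count p n = 2 := by
    rw [Nat.count_eq_card_filter_range, Finset.card_eq_two]
    refine ⟨0, m, hm.ne, Finset.ext fun j => ?_⟩
    simp only [Finset.mem_filter, Finset.mem_range, hp, Finset.mem_insert, Finset.mem_singleton]
    omega
  constructor
  · rw [← h1]
    exact Nat.nth_count ((hp m).2 (by simp))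
  · rw [← h2]
    exact Nat.nth_count ((hp n).2 (by simp))

/-- There are `(q - 1) q` triples whose first nonzero entry is the second one, and `q - 1` where it
is the third. -/
theorem Fintype.sum_ite_flag {F : Type*} [Field F] [Fintype F] [DecidableEq F] (m n : ℤ) :
    ∑ p : F × F × F, (if p.1 ≠ 0 then 0 else if p.2.1 ≠ 0 then m else if p.2.2 ≠ 0 then n else 0) =
      ((Fintype.card F : ℤ) - 1) * (Fintype.card F * m + n) := by
  have key : ∀ (f : F → ℤ) (A : ℤ), (∀ x ≠ 0, f x = A) →
      ∑ x, f x = ((Fintype.card F : ℤ) - 1) * A + f 0 := fun f A hf => by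
    rw [← Finset.sum_erase_add _ _ (Finset.mem_univ (0 : F)),
      Finset.sum_congr rfl fun x hx => hf x (Finset.ne_of_mem_erase hx), Finset.sum_const,
      Finset.card_erase_of_mem (Finset.mem_univ _), Finset.card_univ, nsmul_eq_mul,
      Nat.cast_sub Fintype.card_pos, Nat.cast_one]
  simp only [Fintype.sum_prod_type]
  rw [key _ 0 fun x hx => by simp [hx], key _ (Fintype.card F * m) fun y hy => by simp [hy],
    key _ n fun z hz => by simp [hz]]
  simp
  ring

namespace PlaneCurve

variable {F : Type*} [Field F] [Fintype F] {d : ℕ} {C : PlaneCurve F d}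

namespace Point

/-- Gaussian elimination by residues: since residues lie in `F`, a form can be modified by an
`F`-multiple of one of no larger order so that its order strictly increases past the latter's. The
three values obtained will be those of the order sequence. -/
theorem exists_flag (hd : 1 < d) {P : C.Point} (hP : P ∈ C.rationalPoints 1) :
    ∃ u v w : Fin 3 → F, w ≠ 0 ∧
      P.val (C.lin (baseChange v)) < P.val (C.lin (baseChange u)) ∧
      P.val (C.lin (baseChange w)) < P.val (C.lin (baseChange v)) := by
  classical
  let V : (Fin 3 → F) → ℤᵐ⁰ := fun a => P.val (C.lin (baseChange a))
  -- Maximal value means minimal order, so residues relative to `u` exist for all forms. The form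
  -- `v` is chosen likewise among those of strictly larger order.
  obtain ⟨u, hu, humax⟩ := Finset.exists_max_image (Finset.univ.filter fun a : Fin 3 → F => a ≠ 0) V
    ⟨Pi.single 0 1, by simp⟩
  simp only [Finset.mem_filter, Finset.mem_univ, true_and] at hu humax
  obtain ⟨y, hy⟩ := exists_linearIndependent_pair_of_one_lt_finrank
    (R := F) (M := Fin 3 → F) (by simp) hu
  obtain ⟨c, hc⟩ := exists_val_lin_baseChange_lt hd hP hu y (humax y (hy.ne_zero 1))
  have hy0 : y - c • u ≠ 0 := fun h0 =>
    (LinearIndependent.pair_iff' hu).1 hy c (sub_eq_zero.1 h0).symm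
  obtain ⟨v, hv, hvmax⟩ := Finset.exists_max_image
    (Finset.univ.filter fun a : Fin 3 → F => a ≠ 0 ∧ V a < V u) V ⟨y - c • u, by simpa using ⟨hy0, hc⟩⟩
  simp only [Finset.mem_filter, Finset.mem_univ, true_and] at hv hvmax
  have huv : LinearIndependent F ![u, v] := by
    rw [LinearIndependent.pair_iff' hu]
    intro c hcv
    have hc0 : c ≠ 0 := by
      rintro rfl
      exact hv.1 (by simpa using hcv.symm)
    have := hv.2
    rw [← hcv] at this
    exact this.ne (P.val_baseChange_smul hc0 u)
  obtain ⟨z, hz⟩ := exists_linearIndependent_snoc_of_lt_finrank huv (by simp)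
  have hz' := Fintype.linearIndependent_iff.1 hz
  have hz0 : ∀ a b : F, z - a • u - b • v ≠ 0 := by
    intro a b h0
    have := hz' ![-a, -b, 1] (by
      rw [Fin.sum_univ_three, ← h0]
      change -a • u + -b • v + (1 : F) • z = _
      module) 2
    simp at this
  have hz1 : z ≠ 0 := by simpa using hz0 0 0
  obtain ⟨a, ha⟩ := exists_val_lin_baseChange_lt hd hP hu z (humax z hz1)
  have ha0 : z - a • u ≠ 0 := by simpa using hz0 a 0
  obtain ⟨b, hb⟩ := exists_val_lin_baseChange_lt hd hP hv.1 (z - a • u) (hvmax _ ⟨ha0, ha⟩)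
  exact ⟨u, v, _, hz0 a b, hv.2, hb⟩

/-- The multiplicities at a rational point, summed over the nonzero linear forms over `F`. -/
theorem sum_mult_baseChange_eq [DecidableEq F] (hd : 1 < d) {P : C.Point}
    (hP : P ∈ C.rationalPoints 1) :
    ∑ a : Fin 3 → F, (if a = 0 then 0 else P.mult (baseChange a)) =
      ((Fintype.card F : ℤ) - 1) * (Fintype.card F * P.order 1 + P.order 2) := by
  classical
  obtain ⟨u, v, w, hw, hvu, hwv⟩ := exists_flag hd hP
  have hv : v ≠ 0 := by
    rintro rfl
    simp at hwv
  have hu : u ≠ 0 := by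
    rintro rfl
    simp at hvu
  have hval := P.val.map_add_add_eq_ite P.val_algebraMap_le_one hvu hwv
  simp only [← map_smul, ← map_add] at hval
  have hu' := baseChange_ne_zero hu
  have hv' := baseChange_ne_zero hv
  have hw' := baseChange_ne_zero hw
  have hmult : ∀ a b c : AlgebraicClosure F,
      a • baseChange u + b • baseChange v + c • baseChange w ≠ 0 →
      P.mult (a • baseChange u + b • baseChange v + c • baseChange w) =
        if a ≠ 0 then P.mult (baseChange u) else if b ≠ 0 then P.mult (baseChange v)
          else P.mult (baseChange w) := by
    intro a b c h0
    have h := hval a b c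
    rw [mult, ord_eq, h]
    split_ifs with ha hb hc
    · rfl
    · rfl
    · rfl
    · rw [not_ne_iff.1 ha, not_ne_iff.1 hb, not_ne_iff.1 hc] at h0
      simp at h0
  have hzero : ∀ a b c : AlgebraicClosure F,
      a • baseChange u + b • baseChange v + c • baseChange w = 0 → a = 0 ∧ b = 0 ∧ c = 0 := by
    intro a b c h0
    have h := hval a b c
    rw [h0, map_zero, map_zero] at h
    have h1 := P.val_ne_zero (C.lin_ne_zero hd hu')
    have h2 := P.val_ne_zero (C.lin_ne_zero hd hv')
    have h3 := P.val_ne_zero (C.lin_ne_zero hd hw')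
    split_ifs at h with ha hb hc
    · exact absurd h.symm h1
    · exact absurd h.symm h2
    · exact absurd h.symm h3
    · exact ⟨not_ne_iff.1 ha, not_ne_iff.1 hb, not_ne_iff.1 hc⟩
  -- The flag over `F` is also a basis over the algebraic closure, so its multiplicities exhaust the
  -- orders attained by all geometric lines.
  have hspan : ∀ x : Fin 3 → AlgebraicClosure F, ∃ a b c : AlgebraicClosure F,
      x = a • baseChange u + b • baseChange v + c • baseChange w := by
    have hli : LinearIndependent (AlgebraicClosure F)
        ![baseChange u, baseChange v, baseChange w] := by
      rw [Fintype.linearIndependent_iff]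
      intro g hg i
      rw [Fin.sum_univ_three] at hg
      obtain ⟨h1, h2, h3⟩ := hzero _ _ _ hg
      fin_cases i <;> assumption
    intro x
    have hx : x ∈ Submodule.span (AlgebraicClosure F)
        (Set.range ![baseChange u, baseChange v, baseChange w]) := by
      rw [hli.span_eq_top_of_card_eq_finrank (by simp)]
      trivial
    obtain ⟨g, hg⟩ := (Submodule.mem_span_range_iff_exists_fun _).1 hx
    rw [Fin.sum_univ_three] at hg
    exact ⟨_, _, _, hg.symm⟩
  rw [P.val_lin hd hu', P.val_lin hd hv', exp_lt_exp] at hvu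
  rw [P.val_lin hd hv', P.val_lin hd hw', exp_lt_exp] at hwv
  -- A coordinate of minimal order has multiplicity `0`, and `u` has the least multiplicity in the
  -- flag.
  have hu0 : P.mult (baseChange u) = 0 := by
    obtain ⟨i, hi⟩ := P.exists_val_coord_eq hd
    obtain ⟨a, b, c, habc⟩ := hspan (Pi.single i 1)
    have h0 : (Pi.single i 1 : Fin 3 → AlgebraicClosure F) ≠ 0 := by simp
    have h1 := hmult a b c (habc ▸ h0)
    rw [← C.lin_single, P.val_lin hd h0, exp_inj, habc] at hi
    have h2 := P.mult_nonneg hd hu'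
    split_ifs at h1 <;> linarith
  obtain ⟨m, hm⟩ := Int.eq_ofNat_of_zero_le (P.mult_nonneg hd hv')
  obtain ⟨n, hn⟩ := Int.eq_ofNat_of_zero_le (P.mult_nonneg hd hw')
  obtain ⟨h1, h2⟩ := Nat.nth_eq_of_iff (p := P.IsOrder) (m := m) (n := n) (by omega) (by omega) (by
    intro j
    rw [isOrder_iff]
    constructor
    · rintro ⟨x, hx, hj⟩
      obtain ⟨a, b, c, rfl⟩ := hspan x
      rw [hmult a b c hx] at hj
      split_ifs at hj <;> omega
    · rintro (rfl | rfl | rfl)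
      · exact ⟨_, hu', by simp [hu0]⟩
      · exact ⟨_, hv', hm.symm⟩
      · exact ⟨_, hw', hn.symm⟩)
  rw [order, order, h1, h2, ← Fintype.sum_ite_flag]
  -- Reindex the forms over `F` by their coordinates in the flag; the first nonzero coordinate
  -- decides the multiplicity.
  let f : F × F × F → (Fin 3 → F) := fun p => p.1 • u + p.2.1 • v + p.2.2 • w
  have hfb : ∀ p, baseChange (f p) = algebraMap F (AlgebraicClosure F) p.1 • baseChange u +
      algebraMap F (AlgebraicClosure F) p.2.1 • baseChange v +
      algebraMap F (AlgebraicClosure F) p.2.2 • baseChange w := fun p => by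
    rw [map_add, map_add, baseChange_smul, baseChange_smul, baseChange_smul]
  have hf0 : ∀ p, f p = 0 → p = 0 := fun p hp => by
    have := hfb p
    rw [hp, map_zero] at this
    obtain ⟨h1, h2, h3⟩ := hzero _ _ _ this.symm
    simp only [map_eq_zero] at h1 h2 h3
    exact Prod.ext h1 (Prod.ext h2 h3)
  have hf : Function.Bijective f := by
    rw [Fintype.bijective_iff_injective_and_card]
    constructor
    · intro p p' h
      refine sub_eq_zero.1 (hf0 (p - p') ?_)
      rw [← sub_eq_zero.2 h]
      simp only [f, Prod.fst_sub, Prod.snd_sub]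
      module
    · simp only [Fintype.card_prod, Fintype.card_pi_const]
      ring
  rw [← hf.sum_comp]
  refine Finset.sum_congr rfl fun p _ => ?_
  by_cases hp : f p = 0
  · rw [if_pos hp, hf0 p hp]
    simp
  · have := hmult _ _ _ (by rw [← hfb p]; exact baseChange_ne_zero hp)
    rw [if_neg hp, hfb p, this, hu0, hm, hn]
    have hp' : ¬ (p.1 = 0 ∧ p.2.1 = 0 ∧ p.2.2 = 0) := by
      rintro ⟨h1, h2, h3⟩
      exact hp (by simp [f, h1, h2, h3])
    simp only [ne_eq, map_eq_zero]
    split_ifs <;> tauto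

/-- The `q - 1` nonzero multiples of one form through `P` each contribute at least `1`, and no form
contributes negatively. -/
theorem le_sum_mult_baseChange [DecidableEq F] (hd : 1 < d) {P : C.Point}
    (hP : P ∈ C.rationalPoints 2) :
    (Fintype.card F : ℤ) - 1 ≤ ∑ a : Fin 3 → F, (if a = 0 then 0 else P.mult (baseChange a)) := by
  obtain ⟨a, ha, h1⟩ := exists_one_le_mult hd hP
  have hinj : Function.Injective fun c : F => c • a := smul_left_injective F ha
  calc (Fintype.card F : ℤ) - 1 = ∑ c : F, if c = 0 then (0 : ℤ) else 1 := by
        rw [Finset.sum_ite]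
        simp [Finset.filter_ne', Finset.card_erase_of_mem, Nat.cast_sub Fintype.card_pos]
    _ ≤ ∑ c : F, if c • a = 0 then 0 else P.mult (baseChange (c • a)) := by
        refine Finset.sum_le_sum fun c _ => ?_
        by_cases hc : c = 0
        · simp [hc]
        · rw [if_neg hc, if_neg (smul_ne_zero hc ha), baseChange_smul,
            P.mult_smul (by simpa using hc)]
          exact h1
    _ = ∑ b ∈ Finset.univ.image fun c : F => c • a,
          if b = 0 then 0 else P.mult (baseChange b) := by
        rw [Finset.sum_image hinj.injOn]
    _ ≤ _ := by
        refine Finset.sum_le_sum_of_subset_of_nonneg (Finset.subset_univ _) fun b _ _ => ?_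
        split_ifs with hb
        · exact le_rfl
        · exact P.mult_nonneg hd (baseChange_ne_zero hb)

theorem sum_sum_mult_baseChange_le [DecidableEq F] (hd : 1 < d) (S : Finset C.Point) :
    ∑ P ∈ S, ∑ a : Fin 3 → F, (if a = 0 then 0 else P.mult (baseChange a)) ≤
      ((Fintype.card F : ℤ) - 1) * (d * ((Fintype.card F : ℤ) ^ 2 + Fintype.card F + 1)) := by
  rw [Finset.sum_comm]
  calc _ ≤ ∑ a : Fin 3 → F, if a = 0 then (0 : ℤ) else d := by
        refine Finset.sum_le_sum fun a _ => ?_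
        split_ifs with ha
        · simp
        · exact sum_mult_le hd S (baseChange_ne_zero ha)
    _ = _ := by
        rw [Finset.sum_ite, Finset.sum_const_zero, Finset.sum_const, zero_add, Finset.filter_ne',
          Finset.card_erase_of_mem (Finset.mem_univ _), Finset.card_univ, nsmul_eq_mul,
          Nat.cast_sub Fintype.card_pos, Fintype.card_pi_const]
        push_cast
        ring

end Point

/-! ### Finiteness and the final count -/

theorem finite_rationalPoints_two (hd : 1 < d) (C : PlaneCurve F d) :
    (C.rationalPoints 2).Finite := by
  classical
  by_contra hinf
  have hq : (1 : ℤ) < Fintype.card F := by exact_mod_cast Fintype.one_lt_card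
  -- Each point contributes at least `q - 1`, so one point more than `d (q² + q + 1)` exceeds the
  -- total allowed by the lines.
  obtain ⟨S, hS, hcard⟩ := Set.Infinite.exists_subset_card_eq hinf
    (d * (Fintype.card F ^ 2 + Fintype.card F + 1) + 1)
  have h1 := Point.sum_sum_mult_baseChange_le hd S
  have h2 := Finset.sum_le_sum fun P hP => Point.le_sum_mult_baseChange hd (hS hP)
  rw [Finset.sum_const, hcard, nsmul_eq_mul] at h2
  have h3 := h2.trans h1
  rw [mul_comm, mul_le_mul_iff_right₀ (by linarith)] at h3
  push_cast at h3
  linarith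

end PlaneCurve

theorem corollary4p7 {F : Type*} [Field F] [Fintype F] (q d : ℕ) (hq : q = Fintype.card F)
    (hd : 1 < d) (C : PlaneCurve F d) :
    (C.rationalPoints 1).Finite ∧ (C.rationalPoints 2).Finite ∧
    ((q : ℤ) + 1) * C.numPoints 1 + C.numPoints 2 ≤
      (d : ℤ) * ((q : ℤ) ^ 2 + q + 1) -
        ∑ᶠ P ∈ C.rationalPoints 1,
          ((q : ℤ) * ((P.order 1 : ℤ) - 1) + ((P.order 2 : ℤ) - 2)) := by
  classical
  subst hq
  have hq : (1 : ℤ) < Fintype.card F := by exact_mod_cast Fintype.one_lt_card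
  have hfin2 := C.finite_rationalPoints_two hd
  have hsub := C.rationalPoints_one_subset 2
  have hfin1 := hfin2.subset hsub
  refine ⟨hfin1, hfin2, ?_⟩
  rw [finsum_mem_eq_finite_toFinset_sum _ hfin1, PlaneCurve.numPoints, PlaneCurve.numPoints,
    Set.ncard_eq_toFinset_card _ hfin1, Set.ncard_eq_toFinset_card _ hfin2]
  set S := hfin1.toFinset with hS
  set T := hfin2.toFinset with hT
  have hST : S ⊆ T := Set.Finite.toFinset_subset_toFinset.2 hsub
  have h1 := PlaneCurve.Point.sum_sum_mult_baseChange_le hd T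
  rw [← Finset.sum_sdiff hST] at h1
  have h2 : ∑ P ∈ T \ S, ((Fintype.card F : ℤ) - 1) ≤ _ := Finset.sum_le_sum fun P hP =>
    PlaneCurve.Point.le_sum_mult_baseChange hd
      ((hfin2.mem_toFinset).1 (Finset.mem_sdiff.1 hP).1)
  rw [Finset.sum_congr rfl fun P hP =>
    PlaneCurve.Point.sum_mult_baseChange_eq hd ((hfin1.mem_toFinset).1 hP), ← Finset.mul_sum] at h1
  rw [Finset.sum_const, Finset.card_sdiff_of_subset hST, nsmul_eq_mul,
    Nat.cast_sub (Finset.card_le_card hST), mul_comm] at h2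
  have h3 := (add_le_add_left h2 _).trans h1
  rw [← mul_add, mul_le_mul_iff_right₀ (by linarith)] at h3
  -- Shifting the orders by `1` and `2` costs `q + 2` per point of `S`; with the `N₂ - N₁` from `T \
  -- S` this leaves `(q + 1) N₁ + N₂`.
  have h4 : ∑ P ∈ S, ((Fintype.card F : ℤ) * ((P.order 1 : ℤ) - 1) + ((P.order 2 : ℤ) - 2)) =
      ∑ P ∈ S, ((Fintype.card F : ℤ) * P.order 1 + P.order 2) - S.card * (Fintype.card F + 2) := by
    rw [← nsmul_eq_mul, ← Finset.sum_const, ← Finset.sum_sub_distrib]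
    exact Finset.sum_congr rfl fun P _ => by ring
  rw [h4]
  linarith
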